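/- All cohomology has integer coefficients, and $H^n_c$ denotes cohomology with compact supports (sheaf cohomology with compact supports and constant coefficients $\mathbb Z$, equivalently, on locally compact Hausdorff spaces, Alexander–Spanier cohomology with compact supports). For a locally compact Hausdorff space $X$ and $n \ge 0$, the $n$-th compactly supported cohomology at infinity of $X$ is the inverse limit $$H^n_{c_\infty}(X;\mathbb Z) := \varprojlim_{K \subset X \text{ compact}} H^n_c(X, K; \mathbb Z),$$ where for $K \subset L$ the transition map $H^n_c(X,L;\mathbb Z) \to H^n_c(X,K;\mathbb Z)$ is induced by the identity, viewed as a map of pairs $(X,K)\to(X,L)$. A proper map $f : X \to Y$ between locally compact Hausdorff spaces induces a homomorphism $f^* : H^n_{c_\infty}(Y;\mathbb Z) \to H^n_{c_\infty}(X;\mathbb Z)$: for compact $K \subset X$, the component of $f^*(a)$ at $K$ is the image of the component of $a$ at $f(K)$ under the map $H^n_c(Y,f(K);\mathbb Z) \to H^n_c(X,K;\mathbb Z)$ induced by $f$. (Equivalently, for compact $L \subset Y$, the component of $f^*(a)$ at $f^{-1}(L)$ is the image of the component of $a$ at $L$.) Two proper maps $f, g : X \to Y$ are properly homotopic if there is a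 homotopy $H : X \times [0,1] \to Y$ from $f$ to $g$ that is a proper map. A proper map $f : X \to Y$ is a proper homotopy equivalence if there is a proper map $g : Y \to X$ such that $g \circ f$ and $f \circ g$ are properly homotopic to the identity maps of $X$ and $Y$. Compactly supported cohomology at infinity is a proper homotopy invariant of locally compact Hausdorff spaces. That is, let $X$ and $Y$ be locally compact Hausdorff spaces and let $n \ge 0$. Then: 1. if $f, g : X \to Y$ are properly homotopic proper maps, then $f^* = g^* : H^n_{c_\infty}(Y;\mathbb Z) \to H^n_{c_\infty}(X;\mathbb Z)$; 2. if $f : X \to Y$ is a proper homotopy equivalence, then $f^* : H^n_{c_\infty}(Y;\mathbb Z) \to H^n_{c_\infty}(X;\mathbb Z)$ is an isomorphism. -/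

import Mathlib

/-!
Compactly supported cohomology with integer coefficients, in the Alexander-Spanier model.  On
locally compact Hausdorff spaces this is canonically the sheaf cohomology with compact supports of
the constant sheaf `ℤ`; on locally contractible ones it is also the singular theory with compact
supports.
-/

open Topology TopologicalSpace Set

universe u v w

noncomputable section

namespace CohomologyAtInfinity

/-- Alexander-Spanier `n`-cochains of `X`: arbitrary integer functions of `n + 1` points. -/
abbrev Cochain (n : ℕ) (X : Type u) : Type u := (Fin (n + 1) → X) → ℤ

/-- The coboundary `(δ φ)(x₀, …, xₙ₊₁) = ∑ᵢ (-1)ⁱ φ(x₀, …, x̂ᵢ, …, xₙ₊₁)`. -/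
def coboundary (n : ℕ) (X : Type u) : Cochain n X →+ Cochain (n + 1) X where
  toFun φ := fun x => ∑ i : Fin (n + 2), (-1 : ℤ) ^ (i : ℕ) * φ (fun j => x (i.succAbove j))
  map_zero' := by
    funext x
    simp
  map_add' φ ψ := by
    funext x
    simp [mul_add, Finset.sum_add_distrib]

/-- Pulling cochains back along a map, `(f^* φ)(x₀, …, xₙ) = φ(f x₀, …, f xₙ)`. -/
def cochainMap (n : ℕ) {X : Type u} {Y : Type v} (f : X → Y) : Cochain n Y →+ Cochain n X where
  toFun φ := fun x => φ (fun j => f (x j))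
  map_zero' := rfl
  map_add' _ _ := rfl

theorem coboundary_cochainMap (n : ℕ) {X : Type u} {Y : Type v} (f : X → Y) (φ : Cochain n Y) :
    coboundary n X (cochainMap n f φ) = cochainMap (n + 1) f (coboundary n Y φ) := rfl

section Spaces

variable {X : Type u} [TopologicalSpace X] {Y : Type v} [TopologicalSpace Y]
  {Z : Type w} [TopologicalSpace Z]

/-- The restriction of `φ` to the subspace `A` is locally zero: every point of `A` has a
neighbourhood in `A` such that `φ` vanishes on all tuples of points of that neighbourhood. -/
def LocallyZeroOn {n : ℕ} (A : Set X) (φ : Cochain n X) : Prop :=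
  ∀ a ∈ A, ∃ U ∈ 𝓝 a, ∀ x : Fin (n + 1) → X, (∀ j, x j ∈ U ∩ A) → φ x = 0

theorem LocallyZeroOn.zero {n : ℕ} (A : Set X) : LocallyZeroOn A (0 : Cochain n X) :=
  fun _ _ => ⟨univ, Filter.univ_mem, fun _ _ => rfl⟩

theorem LocallyZeroOn.add {n : ℕ} {A : Set X} {φ ψ : Cochain n X} (hφ : LocallyZeroOn A φ)
    (hψ : LocallyZeroOn A ψ) : LocallyZeroOn A (φ + ψ) := by
  intro a ha
  obtain ⟨U, hU, hUφ⟩ := hφ a ha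
  obtain ⟨V, hV, hVψ⟩ := hψ a ha
  refine ⟨U ∩ V, Filter.inter_mem hU hV, fun x hx => ?_⟩
  rw [Pi.add_apply, hUφ x fun j => ⟨(hx j).1.1, (hx j).2⟩,
    hVψ x fun j => ⟨(hx j).1.2, (hx j).2⟩, add_zero]

theorem LocallyZeroOn.neg {n : ℕ} {A : Set X} {φ : Cochain n X} (hφ : LocallyZeroOn A φ) :
    LocallyZeroOn A (-φ) := by
  intro a ha
  obtain ⟨U, hU, hUφ⟩ := hφ a ha
  exact ⟨U, hU, fun x hx => by rw [Pi.neg_apply, hUφ x hx, neg_zero]⟩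

theorem LocallyZeroOn.cochainMap {n : ℕ} {A : Set X} {B : Set Y} {f : X → Y} (hf : Continuous f)
    (hAB : MapsTo f A B) {φ : Cochain n Y} (hφ : LocallyZeroOn B φ) :
    LocallyZeroOn A (cochainMap n f φ) := by
  intro a ha
  obtain ⟨U, hU, hUφ⟩ := hφ (f a) (hAB ha)
  exact ⟨f ⁻¹' U, hf.continuousAt hU, fun x hx => hUφ _ fun j => ⟨(hx j).1, hAB (hx j).2⟩⟩

variable (X) in
/-- The subgroup of locally zero cochains. -/
def locallyZero (n : ℕ) : AddSubgroup (Cochain n X) where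
  carrier := {φ | LocallyZeroOn univ φ}
  zero_mem' := LocallyZeroOn.zero univ
  add_mem' := LocallyZeroOn.add
  neg_mem' := LocallyZeroOn.neg

/-- The cochains that have compact support (they are locally zero on the complement of some compact
set) and restrict to a locally zero cochain on `A`.  Their classes modulo locally zero cochains are
the compactly supported relative Alexander-Spanier cochains of the pair `(X, A)`. -/
def relCochains (n : ℕ) (A : Set X) : AddSubgroup (Cochain n X) where
  carrier := {φ | LocallyZeroOn A φ ∧ ∃ L : Set X, IsCompact L ∧ LocallyZeroOn Lᶜ φ}
  zero_mem' := ⟨LocallyZeroOn.zero A, ∅, isCompact_empty, LocallyZeroOn.zero _⟩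
  add_mem' := by
    rintro φ ψ ⟨hφ, L, hL, hLφ⟩ ⟨hψ, M, hM, hMψ⟩
    have key : ∀ {S T : Set X} {χ : Cochain n X}, S ⊆ T → LocallyZeroOn T χ → LocallyZeroOn S χ :=
      fun hST hχ => LocallyZeroOn.cochainMap continuous_id (fun _ hx => hST hx) hχ
    exact ⟨hφ.add hψ, L ∪ M, hL.union hM,
      (key (compl_subset_compl.2 subset_union_left) hLφ).add
        (key (compl_subset_compl.2 subset_union_right) hMψ)⟩
  neg_mem' := by
    rintro φ ⟨hφ, L, hL, hLφ⟩
    exact ⟨hφ.neg, L, hL, hLφ.neg⟩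

/-- Relative cochains with compact support whose coboundary is locally zero, that is, which
represent cocycles modulo locally zero cochains. -/
def cocycles (n : ℕ) (A : Set X) : AddSubgroup (Cochain n X) :=
  relCochains n A ⊓ (locallyZero X (n + 1)).comap (coboundary n X)

/-- Cochains that represent coboundaries modulo locally zero cochains. -/
def coboundaries : (n : ℕ) → (A : Set X) → AddSubgroup (Cochain n X)
  | 0, _ => locallyZero X 0
  | n + 1, A => locallyZero X (n + 1) ⊔ (relCochains n A).map (coboundary n X)

/-- The relative compactly supported cohomology group `H^n_c(X, A; ℤ)`: the `n`-th cohomology of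
the complex of compactly supported relative cochains modulo locally zero cochains. -/
abbrev RelCohomology (n : ℕ) (A : Set X) : Type u :=
  cocycles n A ⧸ (coboundaries n A).addSubgroupOf (cocycles n A)

theorem relCochains_cochainMap {n : ℕ} {A : Set X} {B : Set Y} {f : X → Y} (hf : IsProperMap f)
    (hAB : MapsTo f A B) {φ : Cochain n Y} (hφ : φ ∈ relCochains n B) :
    cochainMap n f φ ∈ relCochains n A := by
  obtain ⟨hφB, L, hL, hLφ⟩ := hφ
  exact ⟨hφB.cochainMap hf.continuous hAB, f ⁻¹' L, hf.isCompact_preimage hL,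
    hLφ.cochainMap hf.continuous fun _ hx => hx⟩

theorem cocycles_cochainMap {n : ℕ} {A : Set X} {B : Set Y} {f : X → Y} (hf : IsProperMap f)
    (hAB : MapsTo f A B) {φ : Cochain n Y} (hφ : φ ∈ cocycles n B) :
    cochainMap n f φ ∈ cocycles n A :=
  ⟨relCochains_cochainMap hf hAB hφ.1,
    LocallyZeroOn.cochainMap (n := n + 1) hf.continuous (mapsTo_univ f univ) hφ.2⟩

theorem coboundaries_cochainMap {n : ℕ} {A : Set X} {B : Set Y} {f : X → Y} (hf : IsProperMap f)
    (hAB : MapsTo f A B) {φ : Cochain n Y} (hφ : φ ∈ coboundaries n B) :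
    cochainMap n f φ ∈ coboundaries n A := by
  cases n with
  | zero => exact LocallyZeroOn.cochainMap hf.continuous (mapsTo_univ f univ) hφ
  | succ n =>
    obtain ⟨ψ, hψ, _, ⟨χ, hχ, rfl⟩, rfl⟩ := AddSubgroup.mem_sup.1 hφ
    rw [map_add, ← coboundary_cochainMap]
    exact AddSubgroup.add_mem_sup
      (LocallyZeroOn.cochainMap (n := n + 1) hf.continuous (mapsTo_univ f univ) hψ)
      (AddSubgroup.mem_map_of_mem _ (relCochains_cochainMap hf hAB hχ))

/-- The restriction of `cochainMap` to cocycles. -/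
def cocyclesMap (n : ℕ) {A : Set X} {B : Set Y} {f : X → Y} (hf : IsProperMap f)
    (hAB : MapsTo f A B) : cocycles n B →+ cocycles n A :=
  ((cochainMap n f).comp (cocycles n B).subtype).codRestrict (cocycles n A)
    fun φ => cocycles_cochainMap hf hAB φ.2

/-- The homomorphism `H^n_c(Y, B; ℤ) → H^n_c(X, A; ℤ)` induced by a proper map of pairs
`f : (X, A) → (Y, B)`. -/
def relMap (n : ℕ) {A : Set X} {B : Set Y} {f : X → Y} (hf : IsProperMap f)
    (hAB : MapsTo f A B) : RelCohomology n B →+ RelCohomology n A :=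
  QuotientAddGroup.map _ _ (cocyclesMap n hf hAB)
    fun _ hφ => coboundaries_cochainMap hf hAB hφ

theorem relMap_relMap (n : ℕ) {A : Set X} {B : Set Y} {C : Set Z} {f : X → Y} {g : Y → Z}
    (hf : IsProperMap f) (hg : IsProperMap g) (hAB : MapsTo f A B) (hBC : MapsTo g B C)
    (a : RelCohomology n C) :
    relMap n hf hAB (relMap n hg hBC a) = relMap n (hg.comp hf) (hBC.comp hAB) a := by
  induction a using QuotientAddGroup.induction_on with
  | H φ => rfl

/-- For `A ⊆ B`, the homomorphism `H^n_c(X, B; ℤ) → H^n_c(X, A; ℤ)` induced by the identity. -/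
def relRestrict (n : ℕ) {A B : Set X} (h : A ⊆ B) : RelCohomology n B →+ RelCohomology n A :=
  relMap n (f := id) isProperMap_id h

variable (X) in
/-- Compactly supported cohomology at infinity: the inverse limit of the groups `H^n_c(X, K; ℤ)`
over all compact subsets `K` of `X`, realized as the group of compatible families. -/
def cohomologyAtInfinity (n : ℕ) :
    AddSubgroup ((K : Compacts X) → RelCohomology n (K : Set X)) where
  carrier := {a | ∀ (K L : Compacts X) (h : (K : Set X) ⊆ L), relRestrict n h (a L) = a K}
  zero_mem' := fun _ _ _ => map_zero _
  add_mem' := fun ha hb K L h => by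
    rw [Pi.add_apply, Pi.add_apply, map_add, ha K L h, hb K L h]
  neg_mem' := fun ha K L h => by rw [Pi.neg_apply, Pi.neg_apply, map_neg, ha K L h]

theorem mapsTo_map (f : C(X, Y)) (K : Compacts X) :
    MapsTo f (K : Set X) (K.map f f.continuous : Compacts Y) :=
  mapsTo_image f (K : Set X)

/-- The homomorphism induced on cohomology at infinity by a proper map `f : X → Y`: its component
at a compact set `K ⊆ X` is obtained from the component at `f(K)` through the proper map of pairs
`(X, K) → (Y, f(K))`. -/
def pullback (n : ℕ) (f : C(X, Y)) (hf : IsProperMap f) :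
    cohomologyAtInfinity Y n →+ cohomologyAtInfinity X n where
  toFun a := ⟨fun K => relMap n hf (mapsTo_map f K) (a.1 (K.map f f.continuous)), fun K L h =>
    (relMap_relMap n isProperMap_id hf h (mapsTo_map f L) _).trans <|
      (relMap_relMap n hf isProperMap_id (mapsTo_map f K) (image_mono h) _).symm.trans <|
        congrArg (relMap n hf (mapsTo_map f K)) <|
          a.2 (K.map f f.continuous) (L.map f f.continuous) (image_mono h)⟩
  map_zero' := Subtype.ext <| funext fun _ => map_zero _
  map_add' _ _ := Subtype.ext <| funext fun _ => map_add _ _ _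

/-- The induced homomorphism is the inverse limit of the maps
`H^n_c(Y, L; ℤ) → H^n_c(X, f⁻¹(L); ℤ)`. -/
theorem pullback_apply_preimage (n : ℕ) (f : C(X, Y)) (hf : IsProperMap f)
    (a : cohomologyAtInfinity Y n) (L : Compacts Y) :
    (pullback n f hf a).1 ⟨f ⁻¹' L, hf.isCompact_preimage L.isCompact⟩ =
      relMap n hf (mapsTo_preimage f (L : Set Y)) (a.1 L) :=
  let K : Compacts X := ⟨f ⁻¹' L, hf.isCompact_preimage L.isCompact⟩
  have h : ((K.map f f.continuous : Compacts Y) : Set Y) ⊆ L := image_preimage_subset f (L : Set Y)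
  (congrArg (relMap n hf (mapsTo_map f K)) (a.2 (K.map f f.continuous) L h)).symm.trans <|
    relMap_relMap n hf isProperMap_id (mapsTo_map f K) h (a.1 L)

/-- `f` and `g` are properly homotopic: there is a homotopy between them which, as a map from the
product of the unit interval with `X`, is proper. -/
def ProperlyHomotopic (f g : C(X, Y)) : Prop :=
  ∃ H : ContinuousMap.Homotopy f g, IsProperMap H

/-- `f` is a proper homotopy equivalence: it is proper, and has a proper homotopy inverse. -/
def IsProperHomotopyEquivalence (f : C(X, Y)) : Prop :=
  IsProperMap f ∧ ∃ g : C(Y, X), IsProperMap g ∧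
    ProperlyHomotopic (g.comp f) (ContinuousMap.id X) ∧
    ProperlyHomotopic (f.comp g) (ContinuousMap.id Y)

end Spaces

end CohomologyAtInfinity

end

/-!
Why compactly supported cohomology at infinity is a proper homotopy invariant.

Let `H` be a proper homotopy from `f` to `g` and let `K ⊆ X` be compact.  The trace
`L = H([0,1] × K)` is compact, and the components at `K` of `f^* a` and `g^* a` are both obtained
from the component of `a` at `L`: pull it back along `H` to `H^n_c([0,1] × X, [0,1] × K)`, and then
restrict to the slices at `0` and at `1`.  So it is enough that all slices `X → T × X` over a
connected space `T` induce the same map `H^n_c(T × X, T × K) → H^n_c(X, K)` (`relMap_prodMk_eq`).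

As `T` is connected, it suffices that the restriction of a fixed class to the slice at `t` is
locally constant in `t` (`eventually_cochainMap_sub_mem_coboundaries`).  The prism operator of two
maps is a chain homotopy between the pullbacks of cochains (`coboundary_prism_add`), on the level of
functions of arbitrary tuples of points; the question is whether it preserves local vanishing.  For
the slices at `s` and `t` this needs the cochain, and its coboundary, to vanish on all tuples of
points of `{s, t} × U`, with `U` a neighbourhood of a given point of `X`, and `s` has to work for
all these points at once.  Over a compact subset of `X` this holds for all `s` close to `t`, by the
tube lemma (`LocallyZeroOn.eventually_forall`).  Compactness of the support reduces to this case: up to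
a locally zero cochain, the given one vanishes on every tuple that leaves `T × N`, for some compact
`N ⊆ X` (`sub_indicator_mem_locallyZero`).
-/

namespace CohomologyAtInfinity

/-! ### The prism operator -/

theorem coboundary_apply {Z : Type*} {n : ℕ} (φ : Cochain n Z) (x : Fin (n + 2) → Z) :
    coboundary n Z φ x =
      ∑ i : Fin (n + 2), (-1 : ℤ) ^ (i : ℕ) * φ (fun j => x (i.succAbove j)) :=
  rfl

/-- The coboundary satisfies `(δ φ)(p, x) = φ(x) - δ(φ(p, ·))(x)`. -/
theorem coboundary_cons {Z : Type*} {n : ℕ} (φ : Cochain (n + 1) Z) (p : Z)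
    (x : Fin (n + 2) → Z) :
    coboundary (n + 1) Z φ (Fin.cons p x) =
      φ x - coboundary n Z (fun y => φ (Fin.cons p y)) x := by
  have h : ∀ i : Fin (n + 2), (fun j => (Fin.cons p x : Fin (n + 3) → Z) (i.succ.succAbove j)) =
      (Fin.cons p (fun j => x (i.succAbove j)) : Fin (n + 2) → Z) := by
    intro i
    funext j
    refine Fin.cases ?_ (fun j => ?_) j <;> simp
  rw [coboundary_apply, coboundary_apply, Fin.sum_univ_succ, sub_eq_add_neg,
    ← Finset.sum_neg_distrib]
  congr 1
  · simp
  · refine Finset.sum_congr rfl fun i _ => ?_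
    rw [h i, Fin.val_succ, pow_succ]
    ring

theorem coboundary_zero_cons {Z : Type*} (φ : Cochain 0 Z) (p : Z) (x : Fin 1 → Z) :
    coboundary 0 Z φ (Fin.cons p x) = φ x - φ fun _ => p := by
  have h : (fun j => (Fin.cons p x : Fin 2 → Z) ((1 : Fin 2).succAbove j)) = fun _ => p := by
    funext j
    fin_cases j
    rfl
  rw [coboundary_apply, Fin.sum_univ_two, h]
  simp [sub_eq_add_neg]

/-- The prism operator of two maps `f, g : X → Z`,
`(P φ)(x₀, …, xₙ) = ∑ₖ (-1)ᵏ φ(f x₀, …, f xₖ, g xₖ, …, g xₙ)`. -/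
def prism (n : ℕ) {X Z : Type*} (f g : X → Z) : Cochain (n + 1) Z →+ Cochain n X where
  toFun φ := fun x => ∑ k : Fin (n + 1), (-1 : ℤ) ^ (k : ℕ) *
    φ (fun j => if j ≤ k.castSucc then f (x (k.predAbove j)) else g (x (k.predAbove j)))
  map_zero' := by
    funext x
    simp
  map_add' φ ψ := by
    funext x
    simp [mul_add, Finset.sum_add_distrib]

section Prism

variable {X Z : Type*} (f g : X → Z)

theorem prism_apply {n : ℕ} (φ : Cochain (n + 1) Z) (x : Fin (n + 1) → X) :
    prism n f g φ x = ∑ k : Fin (n + 1), (-1 : ℤ) ^ (k : ℕ) *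
      φ (fun j => if j ≤ k.castSucc then f (x (k.predAbove j)) else g (x (k.predAbove j))) :=
  rfl

theorem prism_zero_apply (φ : Cochain 1 Z) (x : Fin 1 → X) :
    prism 0 f g φ x = φ (Fin.cons (f (x 0)) fun j => g (x j)) := by
  rw [prism_apply, Fin.sum_univ_one]
  simp only [Fin.val_zero, pow_zero, one_mul]
  congr 1
  funext j
  fin_cases j <;> simp

/-- The terms of the prism operator, sorted by whether only the first point `p` is mapped by `f`. -/
theorem prism_cons {n : ℕ} (φ : Cochain (n + 2) Z) (p : X) (x : Fin (n + 1) → X) :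
    prism (n + 1) f g φ (Fin.cons p x) =
      φ (Fin.cons (f p) (Fin.cons (g p) fun j => g (x j))) -
        prism n f g (fun y => φ (Fin.cons (f p) y)) x := by
  rw [prism_apply, prism_apply, Fin.sum_univ_succ, sub_eq_add_neg, ← Finset.sum_neg_distrib]
  congr 1
  · simp only [Fin.val_zero, pow_zero, one_mul]
    congr 1
    funext j
    refine Fin.cases (by simp) (fun j => ?_) j
    refine Fin.cases (by simp) (fun j => ?_) j
    simp
  · refine Finset.sum_congr rfl fun k _ => ?_
    rw [Fin.val_succ, pow_succ, mul_neg_one, neg_mul]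
    congr 3
    funext j
    refine Fin.cases (by simp) (fun j => ?_) j
    simp

/-- The prism operator is a chain homotopy, in degree `0`. -/
theorem prism_coboundary_zero (φ : Cochain 0 Z) :
    prism 0 f g (coboundary 0 Z φ) = cochainMap 0 g φ - cochainMap 0 f φ := by
  funext x
  have h : (fun j => f (x j)) = fun _ => f (x 0) := by
    funext j
    rw [Fin.fin_one_eq_zero j]
  rw [prism_zero_apply, coboundary_zero_cons, ← h]
  rfl

/-- The prism operator is a chain homotopy, in positive degrees.  The proof is by induction on the
degree: with the first point `p` of the tuple fixed, `coboundary_cons` and `prism_cons` reduce the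
identity for `φ` to that for `φ(f p, ·)`. -/
theorem coboundary_prism_add {n : ℕ} (φ : Cochain (n + 1) Z) :
    coboundary n X (prism n f g φ) + prism (n + 1) f g (coboundary (n + 1) Z φ) =
      cochainMap (n + 1) g φ - cochainMap (n + 1) f φ := by
  have cons_coboundary : ∀ {n : ℕ} (φ : Cochain (n + 1) Z) (q : Z),
      (fun y => coboundary (n + 1) Z φ (Fin.cons q y)) =
        φ - coboundary n Z fun y => φ (Fin.cons q y) :=
    fun φ q => funext fun y => coboundary_cons φ q y
  have map_cons : ∀ {n : ℕ} (h : X → Z) (p : X) (x : Fin n → X),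
      (fun j => h ((Fin.cons p x : Fin (n + 1) → X) j)) = Fin.cons (h p) fun j => h (x j) := by
    intro n h p x
    funext j
    refine Fin.cases ?_ (fun j => ?_) j <;> simp
  induction n with
  | zero =>
    funext x
    rw [← Fin.cons_self_tail x]
    generalize x 0 = p, Fin.tail x = x
    rw [Pi.add_apply, coboundary_zero_cons, prism_zero_apply, prism_zero_apply, prism_cons,
      cons_coboundary, map_sub, Pi.sub_apply, prism_coboundary_zero, prism_zero_apply,
      coboundary_cons, coboundary_zero_cons]
    simp only [Pi.sub_apply, cochainMap, AddMonoidHom.coe_mk, ZeroHom.coe_mk, map_cons]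
    ring_nf
  | succ n ih =>
    funext x
    rw [← Fin.cons_self_tail x]
    generalize x 0 = p, Fin.tail x = x
    have h : (fun y => prism (n + 1) f g φ (Fin.cons p y)) =
        cochainMap n g (fun y => φ (Fin.cons (f p) (Fin.cons (g p) y))) -
          prism n f g fun y => φ (Fin.cons (f p) y) :=
      funext fun y => prism_cons f g φ p y
    have key := congrFun (ih fun y => φ (Fin.cons (f p) y)) x
    rw [Pi.add_apply, coboundary_cons, h, map_sub, coboundary_cochainMap, prism_cons,
      cons_coboundary, map_sub, coboundary_cons, coboundary_cons]
    simp only [Pi.sub_apply, Pi.add_apply, cochainMap, AddMonoidHom.coe_mk, ZeroHom.coe_mk,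
      map_cons] at key ⊢
    linarith

end Prism

/-! ### Locally zero cochains -/

section LocallyZero

variable {X : Type*} [TopologicalSpace X]

theorem LocallyZeroOn.mono {n : ℕ} {A B : Set X} (h : A ⊆ B) {φ : Cochain n X}
    (hφ : LocallyZeroOn B φ) : LocallyZeroOn A φ :=
  hφ.cochainMap continuous_id h

theorem LocallyZeroOn.coboundary {n : ℕ} {A : Set X} {φ : Cochain n X} (hφ : LocallyZeroOn A φ) :
    LocallyZeroOn A (coboundary n X φ) := by
  intro a ha
  obtain ⟨U, hU, hUφ⟩ := hφ a ha
  refine ⟨U, hU, fun x hx => (coboundary_apply φ x).trans <| Finset.sum_eq_zero fun i _ => ?_⟩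
  rw [hUφ _ fun j => hx _, mul_zero]

theorem locallyZero_le_cocycles (n : ℕ) (A : Set X) : locallyZero X n ≤ cocycles n A :=
  fun _ hφ => ⟨⟨LocallyZeroOn.mono (subset_univ _) hφ, ∅, isCompact_empty,
    LocallyZeroOn.mono (subset_univ _) hφ⟩, LocallyZeroOn.coboundary hφ⟩

theorem locallyZero_le_coboundaries (n : ℕ) (A : Set X) : locallyZero X n ≤ coboundaries n A := by
  cases n with
  | zero => exact le_rfl
  | succ n => exact le_sup_left

/-- A cochain that is locally zero off a closed set `L` may be set to zero on all tuples that leave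
a given neighbourhood `S` of `L`: this changes it by a locally zero cochain only. -/
theorem sub_indicator_mem_locallyZero {n : ℕ} {L S : Set X} (hL : IsClosed L)
    (hLS : L ⊆ interior S) {φ : Cochain n X} (hφ : LocallyZeroOn Lᶜ φ) :
    φ - indicator {z | ∀ j, z j ∈ S} φ ∈ locallyZero X n := by
  intro a _
  by_cases ha : a ∈ L
  · refine ⟨S, mem_interior_iff_mem_nhds.1 (hLS ha), fun z hz => ?_⟩
    have hzS : z ∈ {z : Fin (n + 1) → X | ∀ j, z j ∈ S} := fun j => (hz j).1
    rw [Pi.sub_apply, indicator_of_mem hzS, sub_self]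
  · obtain ⟨U, hU, hUφ⟩ := hφ a ha
    refine ⟨U ∩ Lᶜ, Filter.inter_mem hU (hL.isOpen_compl.mem_nhds ha), fun z hz => ?_⟩
    have h0 : φ z = 0 := hUφ z fun j => (hz j).1
    rw [Pi.sub_apply, h0, indicator_apply_eq_zero.2 fun _ => h0, sub_zero]

/-- Every point of `A` has a neighbourhood `U` such that `φ` vanishes on all tuples of points of
`f(U ∩ A) ∪ g(U ∩ A)`.  This is what makes the prism operator of `f` and `g` send `φ` to a cochain
that is locally zero on `A`. -/
def LocallyZeroAlong {n : ℕ} {Z : Type*} (f g : X → Z) (A : Set X) (φ : Cochain n Z) : Prop :=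
  ∀ a ∈ A, ∃ U ∈ 𝓝 a, ∀ z : Fin (n + 1) → Z,
    (∀ j, z j ∈ f '' (U ∩ A) ∪ g '' (U ∩ A)) → φ z = 0

theorem LocallyZeroAlong.prism {n : ℕ} {Z : Type*} {f g : X → Z} {A : Set X}
    {φ : Cochain (n + 1) Z} (hφ : LocallyZeroAlong f g A φ) :
    LocallyZeroOn A (prism n f g φ) := by
  intro a ha
  obtain ⟨U, hU, hUφ⟩ := hφ a ha
  refine ⟨U, hU, fun x hx => (prism_apply f g φ x).trans <| Finset.sum_eq_zero fun k _ => ?_⟩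
  rw [hUφ _ fun j => ?_, mul_zero]
  split_ifs
  · exact Or.inl (mem_image_of_mem f (hx _))
  · exact Or.inr (mem_image_of_mem g (hx _))

/-- Two maps `f, g` that are so close together, as seen by `φ` and `δ φ`, that the prism operator
respects supports pull `φ` back to cohomologous cochains. -/
theorem cochainMap_sub_cochainMap_mem_coboundaries {n : ℕ} {Z : Type*} {f g : X → Z} {A L : Set X}
    {φ : Cochain n Z} (hA : LocallyZeroAlong f g A φ) (hL : IsCompact L)
    (hLφ : LocallyZeroAlong f g Lᶜ φ) (hδ : LocallyZeroAlong f g univ (coboundary n Z φ)) :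
    cochainMap n g φ - cochainMap n f φ ∈ coboundaries n A := by
  cases n with
  | zero =>
    rw [← prism_coboundary_zero]
    exact hδ.prism
  | succ n =>
    rw [← coboundary_prism_add, add_comm (coboundary n X _)]
    exact AddSubgroup.add_mem_sup hδ.prism
      (AddSubgroup.mem_map_of_mem _ ⟨hA.prism, L, hL, hLφ.prism⟩)

end LocallyZero

/-! ### Slices of a product with a connected space -/

section Slices

theorem mapsTo_prodMk {T X : Type*} (t : T) (K : Set X) :
    MapsTo (Prod.mk t) K (univ ×ˢ K : Set (T × X)) :=
  fun _ hx => ⟨mem_univ t, hx⟩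

variable {X : Type*} [TopologicalSpace X] {T : Type*} [TopologicalSpace T]

/-- Compactness of `C` makes the slices at `s` and at `t` close together, near all points of `C` at
once, as soon as `s` is close enough to `t`. -/
theorem LocallyZeroOn.eventually_forall {n : ℕ} {A C : Set X} (hC : IsCompact C) (hCA : C ⊆ A)
    {φ : Cochain n (T × X)} (hφ : LocallyZeroOn (univ ×ˢ A) φ) (t : T) :
    ∀ᶠ s in 𝓝 t, ∀ y ∈ C, ∃ U ∈ 𝓝 y, ∀ z : Fin (n + 1) → T × X,
      (∀ j, z j ∈ Prod.mk s '' (U ∩ A) ∪ Prod.mk t '' (U ∩ A)) → φ z = 0 := by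
  refine hC.eventually_forall_of_forall_eventually fun y hy => ?_
  obtain ⟨W, hW, hWφ⟩ := hφ (t, y) ⟨mem_univ t, hCA hy⟩
  obtain ⟨V, hV, U, hU, hVU⟩ := mem_nhds_prod_iff.1 hW
  filter_upwards [prod_mem_nhds hV (interior_mem_nhds.2 hU)] with p hp
  refine ⟨U, mem_interior_iff_mem_nhds.1 hp.2, fun z hz => hWφ z fun j => ?_⟩
  rcases hz j with ⟨x, hx, h⟩ | ⟨x, hx, h⟩
  · exact h ▸ ⟨hVU ⟨hp.1, hx.1⟩, mem_univ _, hx.2⟩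
  · exact h ▸ ⟨hVU ⟨mem_of_mem_nhds hV, hx.1⟩, mem_univ _, hx.2⟩

/-- The restrictions of a compactly supported relative cocycle on `T × X` to nearby slices are
cohomologous. -/
theorem eventually_cochainMap_sub_mem_coboundaries [T2Space X] [LocallyCompactSpace X] [T2Space T]
    {n : ℕ} {K : Set X} (hK : IsCompact K) {φ : Cochain n (T × X)}
    (hφ : φ ∈ cocycles n (univ ×ˢ K : Set (T × X))) (t : T) :
    ∀ᶠ s in 𝓝 t,
      cochainMap n (Prod.mk t) φ - cochainMap n (Prod.mk s) φ ∈ coboundaries n K := by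
  obtain ⟨L, hL, hLφ⟩ := hφ.1.2
  obtain ⟨N, hN, hLN⟩ := exists_compact_superset (hL.image continuous_snd)
  -- Without this truncation, how close `s` has to be to `t` near a point `x` of `X` could depend on
  -- `x` in a way that is not uniform, as `X` is not compact.
  set ψ : Cochain n (T × X) := indicator {z | ∀ j, z j ∈ univ ×ˢ N} φ
  have hφψ : φ - ψ ∈ locallyZero (T × X) n := by
    refine sub_indicator_mem_locallyZero hL.isClosed (fun p hp => ?_) hLφ
    rw [interior_prod_eq, interior_univ]
    exact ⟨mem_univ _, hLN (mem_image_of_mem _ hp)⟩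
  have hψ_mem : ψ ∈ cocycles n (univ ×ˢ K : Set (T × X)) := by
    simpa using sub_mem hφ (locallyZero_le_cocycles n _ hφψ)
  have hψ0 : ∀ z : Fin (n + 1) → T × X, (∃ j, (z j).2 ∉ N) → ψ z = 0 :=
    fun z ⟨j, hj⟩ => indicator_of_notMem (fun h => hj (h j).2) φ
  have hδ : LocallyZeroOn (univ ×ˢ univ) (coboundary n (T × X) ψ) := by
    rw [univ_prod_univ]
    exact hψ_mem.2
  have hslice : ∀ s : T, cochainMap n (Prod.mk s) (φ - ψ) ∈ coboundaries n K := fun s =>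
    locallyZero_le_coboundaries n K <|
      LocallyZeroOn.cochainMap (Continuous.prodMk_right s) (mapsTo_univ _ _) hφψ
  -- Off `N` the cochain `ψ` vanishes for trivial reasons, whatever `s` is.
  have hoff : ∀ s : T, ∀ z : Fin (n + 1) → T × X,
      (∃ j, z j ∈ Prod.mk s '' Nᶜ ∪ Prod.mk t '' Nᶜ) → ψ z = 0 := by
    rintro s z ⟨j, ⟨x, hx, h⟩ | ⟨x, hx, h⟩⟩
    · exact hψ0 z ⟨j, h ▸ hx⟩
    · exact hψ0 z ⟨j, h ▸ hx⟩
  filter_upwards [hψ_mem.1.1.eventually_forall hK Subset.rfl t,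
    hδ.eventually_forall hN (subset_univ N) t] with s hsK hsN
  have hsub : cochainMap n (Prod.mk t) ψ - cochainMap n (Prod.mk s) ψ ∈ coboundaries n K := by
    refine cochainMap_sub_cochainMap_mem_coboundaries hsK hN ?_ ?_
    · exact fun a _ => ⟨univ, Filter.univ_mem, fun z hz =>
        hoff s z ⟨0, by simpa only [univ_inter] using hz 0⟩⟩
    · intro a _
      by_cases ha : a ∈ N
      · exact hsN a ha
      · refine ⟨Nᶜ, hN.isClosed.isOpen_compl.mem_nhds ha, fun z hz =>
          (coboundary_apply ψ z).trans <| Finset.sum_eq_zero fun i _ => ?_⟩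
        rw [hoff s _ ⟨0, by simpa only [inter_univ] using hz _⟩, mul_zero]
  have h := add_mem hsub (sub_mem (hslice t) (hslice s))
  rw [map_sub, map_sub] at h
  convert h using 1
  abel

theorem isProperMap_prodMk [T1Space T] (t : T) : IsProperMap (Prod.mk t : X → T × X) := by
  refine IsClosedEmbedding.isProperMap ⟨isEmbedding_prodMkRight t, ?_⟩
  rw [← image_univ, ← singleton_prod]
  exact isClosed_singleton.prod isClosed_univ

/-- All slices of `T × X` over a connected space `T` induce the same homomorphism: by
`eventually_cochainMap_sub_mem_coboundaries`, the restriction of a class to the slice at `t` is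
locally constant in `t`. -/
theorem relMap_prodMk_eq [T2Space X] [LocallyCompactSpace X] [T2Space T] [PreconnectedSpace T]
    {n : ℕ} {K : Set X} (hK : IsCompact K) (s t : T)
    (a : RelCohomology n (univ ×ˢ K : Set (T × X))) :
    relMap n (isProperMap_prodMk s) (mapsTo_prodMk s K) a =
      relMap n (isProperMap_prodMk t) (mapsTo_prodMk t K) a := by
  induction a using QuotientAddGroup.induction_on with
  | H φ =>
    have hloc : IsLocallyConstant fun r : T =>
        relMap n (isProperMap_prodMk r) (mapsTo_prodMk r K) (φ : RelCohomology n _) := by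
      refine (IsLocallyConstant.iff_eventually_eq _).2 fun r => ?_
      filter_upwards [eventually_cochainMap_sub_mem_coboundaries hK φ.2 r] with q hq
      refine QuotientAddGroup.eq.2 ?_
      rw [neg_add_eq_sub]
      exact hq
    exact hloc.apply_eq_of_preconnectedSpace s t

end Slices

/-! ### Functoriality and homotopy invariance -/

section HomotopyInvariance

variable {X : Type u} [TopologicalSpace X] {Y : Type v} [TopologicalSpace Y]
  {Z : Type w} [TopologicalSpace Z]

/-- The component at `K` of a pulled back class may be computed from the component at any compact
set that contains the image of `K`. -/
theorem pullback_apply {n : ℕ} {f : C(X, Y)} (hf : IsProperMap f) (a : cohomologyAtInfinity Y n)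
    {K : Compacts X} {L : Compacts Y} (h : MapsTo f (K : Set X) L) :
    (pullback n f hf a).1 K = relMap n hf h (a.1 L) :=
  (congrArg (relMap n hf (mapsTo_map f K)) (a.2 (K.map f f.continuous) L h.image_subset)).symm.trans
    (relMap_relMap n hf isProperMap_id (mapsTo_map f K) h.image_subset (a.1 L))

theorem pullback_id (n : ℕ) (h : IsProperMap (ContinuousMap.id X)) :
    pullback n (ContinuousMap.id X) h = AddMonoidHom.id _ := by
  ext a K
  rw [pullback_apply h a (mapsTo_id (K : Set X))]
  exact a.2 K K Subset.rfl

theorem pullback_comp (n : ℕ) {f : C(X, Y)} {g : C(Y, Z)} (hf : IsProperMap f)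
    (hg : IsProperMap g) (h : IsProperMap (g.comp f)) :
    pullback n (g.comp f) h = (pullback n f hf).comp (pullback n g hg) := by
  ext a K
  have hK := mapsTo_map g (K.map f f.continuous)
  rw [pullback_apply h a (hK.comp (mapsTo_map f K)), AddMonoidHom.comp_apply,
    pullback_apply hf _ (mapsTo_map f K), pullback_apply hg a hK, relMap_relMap]

theorem relMap_congr {n : ℕ} {A : Set X} {B : Set Y} {f g : X → Y} (h : f = g)
    (hf : IsProperMap f) (hg : IsProperMap g) (hfAB : MapsTo f A B) (hgAB : MapsTo g A B)
    (a : RelCohomology n B) : relMap n hf hfAB a = relMap n hg hgAB a := by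
  subst h
  rfl

theorem ProperlyHomotopic.pullback_eq [T2Space X] [LocallyCompactSpace X] (n : ℕ) {f g : C(X, Y)}
    (hfg : ProperlyHomotopic f g) (hf : IsProperMap f) (hg : IsProperMap g) :
    pullback n f hf = pullback n g hg := by
  obtain ⟨H, hH⟩ := hfg
  ext a K
  -- The trace of `K` under the homotopy.
  let L : Compacts Y := ⟨H '' (univ ×ˢ (K : Set X)),
    (isCompact_univ.prod K.isCompact).image H.continuous⟩
  have hL : MapsTo H (univ ×ˢ (K : Set X)) L := mapsTo_image H _
  have h0 : H ∘ Prod.mk 0 = f := funext H.apply_zero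
  have h1 : H ∘ Prod.mk 1 = g := funext H.apply_one
  have hfL : MapsTo f (K : Set X) L := h0 ▸ hL.comp (mapsTo_prodMk 0 (K : Set X))
  have hgL : MapsTo g (K : Set X) L := h1 ▸ hL.comp (mapsTo_prodMk 1 (K : Set X))
  have key := relMap_prodMk_eq K.isCompact 0 1 (relMap n hH hL (a.1 L))
  rw [relMap_relMap, relMap_relMap] at key
  rw [pullback_apply hf a hfL, pullback_apply hg a hgL]
  exact (relMap_congr h0.symm _ _ _ _ _).trans (key.trans (relMap_congr h1 _ _ _ _ _))

end HomotopyInvariance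

end CohomologyAtInfinity

theorem mainTheorem8 (n : ℕ)
    {X : Type u} [TopologicalSpace X] [T2Space X] [LocallyCompactSpace X]
    {Y : Type v} [TopologicalSpace Y] [T2Space Y] [LocallyCompactSpace Y] :
    (∀ (f g : C(X, Y)) (hf : IsProperMap f) (hg : IsProperMap g),
      CohomologyAtInfinity.ProperlyHomotopic f g →
        CohomologyAtInfinity.pullback n f hf = CohomologyAtInfinity.pullback n g hg) ∧
    (∀ (f : C(X, Y)) (hf : CohomologyAtInfinity.IsProperHomotopyEquivalence f),
      Function.Bijective (CohomologyAtInfinity.pullback n f hf.1)) := by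
  refine ⟨fun f g hf hg hfg => hfg.pullback_eq n hf hg, fun f hf => ?_⟩
  obtain ⟨hf, g, hg, hgf, hfg⟩ := hf
  have h₁ := (CohomologyAtInfinity.pullback_comp n hf hg (hg.comp hf)).symm.trans <|
    (hgf.pullback_eq n (hg.comp hf) isProperMap_id).trans (CohomologyAtInfinity.pullback_id n _)
  have h₂ := (CohomologyAtInfinity.pullback_comp n hg hf (hf.comp hg)).symm.trans <|
    (hfg.pullback_eq n (hf.comp hg) isProperMap_id).trans (CohomologyAtInfinity.pullback_id n _)
  exact Function.bijective_iff_has_inverse.2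
    ⟨_, fun a => DFunLike.congr_fun h₂ a, fun a => DFunLike.congr_fun h₁ a⟩
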